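/- Let $K:[0,1]\times[0,1]\to\mathbb R$ be the kernel $K(x,y)=\tfrac12-\{(xy)^{-1}\}$ for $0<x,y\le 1$ (where $\{\alpha\}=\alpha-\lfloor\alpha\rfloor$), and $K(x,y)=0$ if $xy=0$. Let $\phi:[0,1]\to\mathbb R$ be an eigenfunction of $K$ with eigenvalue $\lambda\in\mathbb R$; that is, $\phi$ is Lebesgue measurable with $0<\int_0^1\phi(x)^2\,dx<\infty$, and $\phi(x)=\lambda\int_0^1K(x,y)\phi(y)\,dy$ for all $x\in[0,1]$ (so $\lambda\ne0$). Derivatives of $\phi$ are those of a function with domain $[0,1]$, so $\phi'(1)$ is a left-hand derivative. Then: 1. $\phi$ is continuously differentiable on $\left(\tfrac12,1\right]$. 2. The function $y\mapsto\phi(y)/y$ is Lebesgue integrable on $[0,1]$, the series $\sum_{m=2}^\infty\frac{\phi(1/m)}{m}$ converges absolutely, and, with $\Phi_1:=\int_0^1\frac{\phi(y)}{y}\,dy$, $$\phi'(1)=\lambda\Phi_1-\lambda\sum_{m=2}^{\infty}\frac{\phi(1/m)}{m}.$$ 3. For every integer $n\ge2$ the one-sided derivatives $\phi'_{\pm}(1/n):=\lim_{y\to(1/n)\pm}\frac{\phi(y)-\phi(1/n)}{y-1/n}$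 exist and are finite, and $$\phi'_+\left(\tfrac1n\right)-\phi'_-\left(\tfrac1n\right)=-\lambda\,\phi(1)\,n.$$ 4. If $\phi(1)\ne0$, then the set of points of $(0,1]$ at which $\phi$ is not differentiable is exactly $\left\{\tfrac12,\tfrac13,\tfrac14,\dots\right\}$. 5. If $\phi(1)=0$, then $\phi$ is continuously differentiable on $(0,1]$ and, for every $x\in(0,1]$, $$\lambda^{-1}x^2\phi'(x)=\Phi_1-\sum_{m>1/x}\frac{\phi\left(\frac1{mx}\right)}{m},$$ where the series converges absolutely. -/

import Mathlib

open Set MeasureTheory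

noncomputable section

/-- The kernel `K(x,y) = 1/2 - {1/(xy)}` for `0 < x, y ≤ 1`, and `K(x,y) = 0` when `xy = 0`.
Only its values on `[0,1] × [0,1]` are ever used. -/
def fractKernel (x y : ℝ) : ℝ :=
  if 0 < x ∧ 0 < y then 1 / 2 - Int.fract ((x * y)⁻¹) else 0

/-- `φ` (as a function on `[0,1]`; values elsewhere are irrelevant) is an eigenfunction of
`fractKernel` with eigenvalue `lam`: it is square-integrable on `[0,1]`, has positive norm, and
`φ x = lam * ∫₀¹ K(x,y) φ(y) dy` at every point `x` of `[0,1]`. -/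
structure IsKernelEigenfunction (φ : ℝ → ℝ) (lam : ℝ) : Prop where
  memLp : MemLp φ 2 (volume.restrict (Icc (0 : ℝ) 1))
  norm_pos : 0 < Real.sqrt (∫ x in (0 : ℝ)..1, φ x * φ x)
  eigen : ∀ x ∈ Icc (0 : ℝ) 1, φ x = lam * ∫ y in (0 : ℝ)..1, fractKernel x y * φ y

/-- `Φ₁ = ∫₀¹ φ(y)/y dy`. -/
def PhiOne (φ : ℝ → ℝ) : ℝ := ∫ y in (0 : ℝ)..1, φ y / y

/-- The terms of the series `∑_{m > 1/x} φ(1/(mx))/m`, extended by zero to all `m : ℕ`. -/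
def tailTerm (φ : ℝ → ℝ) (x : ℝ) (m : ℕ) : ℝ :=
  if 1 / x < (m : ℝ) then φ (1 / ((m : ℝ) * x)) / (m : ℝ) else 0

end

/-!
Write `ρ s = 1/2 - {s}` for the sawtooth, so that `φ x = lam * ∫₀¹ ρ (1/(xy)) φ y dy` on `(0, 1]`.
The proof rests on an expansion of `φ` into a smooth series plus a locally finite sum that carries
all the corners.

Replacing `{s}` by `s - ∑_{1 ≤ m ≤ s} 1` and integrating term by term gives
`φ x = lam * (c - Φ₁ / x + ∑_{m ≥ 1} G (1/(mx)))`, where `G t = ∫₀^{min t 1} φ`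
(`eq_tsum_setIntegral`). Continue `φ` to the right of `1` by the constant `φ 1` and let `H` be the
primitive of the continuation. Then `H` is `C¹` on `(0, ∞)` and
`G t = H t - φ 1 * max (t - 1) 0`. Hence on `[1/(n+1), 1/n]` the function `φ` coincides with
`smoothPiece φ lam n`, which is `C¹` on all of `(0, ∞)` (`eq_smoothPiece`,
`contDiffOn_smoothPiece`). Consecutive pieces differ by a multiple of `φ 1 * (1/(nx) - 1)`, which
accounts for the jumps of the derivative at `1/n`; if `φ 1 = 0`, all pieces are equal.

Convergence of all the series and integrals follows from the decay `φ x = O(x^(1/4))` at `0`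
(`exists_decay`). This uses the eigenvalue equation twice: since `a ↦ ρ (a / ·)` is Hölder
continuous of order `1/2` into `L¹` (`integral_abs_sawtooth_sub_le`), the function `a ↦ φ (1/a)`
is Hölder continuous; and the rapidly oscillating sawtooth `u ↦ ρ (a u)`, which has mean zero, then
cancels against it in the integral over `u = 1/y` (`abs_integral_sawtooth_mul_le`).
-/

/-! ### The sawtooth function -/

/-- The sawtooth `s ↦ 1/2 - {s}`, which has period `1` and mean zero. -/
noncomputable def sawtooth (s : ℝ) : ℝ := 1 / 2 - Int.fract s

theorem abs_sawtooth_le (s : ℝ) : |sawtooth s| ≤ 1 / 2 := by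
  have h0 := Int.fract_nonneg s
  have h1 := (Int.fract_lt_one s).le
  rw [sawtooth, abs_le]
  constructor <;> linarith

theorem abs_sawtooth_sub_le_one (s t : ℝ) : |sawtooth s - sawtooth t| ≤ 1 := by
  have h1 := abs_le.1 (abs_sawtooth_le s)
  have h2 := abs_le.1 (abs_sawtooth_le t)
  rw [abs_le]
  constructor <;> linarith

theorem measurable_sawtooth : Measurable sawtooth :=
  measurable_const.sub measurable_fract

theorem sawtooth_periodic : Function.Periodic sawtooth 1 := by
  intro s
  simp [sawtooth]

theorem integral_sawtooth : ∫ s in (0 : ℝ)..1, sawtooth s = 0 := by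
  have h : ∫ s in (0 : ℝ)..1, sawtooth s = ∫ s in (0 : ℝ)..1, (1 / 2 - s) := by
    apply intervalIntegral.integral_congr_ae
    have : ∀ᵐ s : ℝ, s ≠ 1 := by simp [ae_iff]
    filter_upwards [this] with s hs hmem
    rw [uIoc_of_le zero_le_one] at hmem
    rw [sawtooth, Int.fract_eq_self.2 ⟨hmem.1.le, lt_of_le_of_ne hmem.2 hs⟩]
  rw [h, intervalIntegral.integral_sub (by simp) (by simp)]
  norm_num [integral_id]

/-- The sawtooth varies by at most the increment of its argument plus the number of integers
passed. -/
theorem abs_sawtooth_sub_le {s t : ℝ} (hs : 0 ≤ s) (hst : s ≤ t) :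
    |sawtooth s - sawtooth t| ≤ (t - s) + ((⌊t⌋₊ : ℝ) - ⌊s⌋₊) := by
  have h1 : Int.fract s = s - ⌊s⌋₊ := by
    rw [Int.fract, ← natCast_floor_eq_intCast_floor hs]
  have h2 : Int.fract t = t - ⌊t⌋₊ := by
    rw [Int.fract, ← natCast_floor_eq_intCast_floor (hs.trans hst)]
  have h3 : (⌊s⌋₊ : ℝ) ≤ ⌊t⌋₊ := by exact_mod_cast Nat.floor_mono hst
  rw [sawtooth, sawtooth, h1, h2, abs_le]
  constructor <;> linarith

theorem abs_sawtooth_div_sub_le {a b ε y : ℝ} (ha : 1 ≤ a) (hab : a ≤ b) (hε : 0 < ε)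
    (hy : y ∈ Ioc (0 : ℝ) 1) :
    |sawtooth (a / y) - sawtooth (b / y)| ≤
      (Ioc 0 ε).indicator (fun _ => (1 : ℝ)) y + (b - a) / ε +
        ∑ m ∈ Finset.Icc ⌈a⌉₊ ⌊b / ε⌋₊, (Icc (a / m) (b / m)).indicator (fun _ => (1 : ℝ)) y := by
  have hsum : ∀ s : Finset ℕ,
      0 ≤ ∑ m ∈ s, (Icc (a / m) (b / m)).indicator (fun _ => (1 : ℝ)) y := fun s =>
    Finset.sum_nonneg fun m _ => indicator_nonneg (fun _ _ => zero_le_one) y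
  have hd : 0 ≤ (b - a) / ε := div_nonneg (sub_nonneg.2 hab) hε.le
  by_cases hyε : y ≤ ε
  · rw [indicator_of_mem (show y ∈ Ioc 0 ε from ⟨hy.1, hyε⟩)]
    linarith [abs_sawtooth_sub_le_one (a / y) (b / y), hsum (Finset.Icc ⌈a⌉₊ ⌊b / ε⌋₊)]
  · push Not at hyε
    rw [indicator_of_notMem (fun h : y ∈ Ioc 0 ε => absurd h.2 (not_le.2 hyε)), zero_add]
    have hs : 0 ≤ a / y := div_nonneg (by linarith) hy.1.le
    have hst : a / y ≤ b / y := div_le_div_of_nonneg_right hab hy.1.le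
    refine (abs_sawtooth_sub_le hs hst).trans (add_le_add ?_ ?_)
    · rw [← sub_div]
      exact div_le_div_of_nonneg_left (sub_nonneg.2 hab) hε hyε.le
    · have hle : ⌊a / y⌋₊ ≤ ⌊b / y⌋₊ := Nat.floor_mono hst
      have hcard : ((⌊b / y⌋₊ : ℝ) - ⌊a / y⌋₊) =
          ∑ m ∈ Finset.Ioc ⌊a / y⌋₊ ⌊b / y⌋₊,
            (Icc (a / m) (b / m)).indicator (fun _ => (1 : ℝ)) y := by
        rw [Finset.sum_congr rfl (g := fun _ => (1 : ℝ))]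
        · rw [Finset.sum_const, Nat.card_Ioc, nsmul_eq_mul, mul_one, Nat.cast_sub hle]
        · intro m hm
          rw [Finset.mem_Ioc] at hm
          have h1 : a / y < m := (Nat.floor_lt hs).1 hm.1
          have h2 : (m : ℝ) ≤ b / y := (Nat.le_floor_iff (hs.trans hst)).1 hm.2
          have hm0 : (0 : ℝ) < m := hs.trans_lt h1
          rw [indicator_of_mem]
          rw [div_lt_iff₀ hy.1] at h1
          rw [le_div_iff₀ hy.1] at h2
          refine ⟨?_, ?_⟩
          · rw [div_le_iff₀ hm0]; linarith
          · rw [le_div_iff₀ hm0]; linarith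
      rw [hcard]
      refine Finset.sum_le_sum_of_subset_of_nonneg ?_
        fun m _ _ => indicator_nonneg (fun _ _ => zero_le_one) y
      intro m hm
      rw [Finset.mem_Ioc] at hm
      have h1 : a / y < m := (Nat.floor_lt hs).1 hm.1
      have h2 : (m : ℝ) ≤ b / y := (Nat.le_floor_iff (hs.trans hst)).1 hm.2
      rw [Finset.mem_Icc]
      constructor
      · refine Nat.ceil_le.2 (le_trans ?_ h1.le)
        rw [le_div_iff₀ hy.1]
        nlinarith [hy.2]
      · refine Nat.le_floor (h2.trans ?_)
        exact div_le_div_of_nonneg_left (by linarith) hε hyε.le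

theorem setIntegral_Ioc_indicator_one_le {u v : ℝ} (s : Set ℝ) (hs : MeasurableSet s)
    (hsub : s ⊆ Icc u v) (huv : u ≤ v) :
    ∫ y in Ioc (0 : ℝ) 1, s.indicator (fun _ => (1 : ℝ)) y ≤ v - u := by
  rw [integral_indicator hs, setIntegral_const, smul_eq_mul, mul_one, Measure.real,
    Measure.restrict_apply hs]
  refine ENNReal.toReal_le_of_le_ofReal (sub_nonneg.2 huv) ?_
  rw [← Real.volume_Icc]
  exact measure_mono (inter_subset_left.trans hsub)

theorem integrableOn_sawtooth_div (a : ℝ) :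
    IntegrableOn (fun y => sawtooth (a / y)) (Ioc 0 1) := by
  refine Measure.integrableOn_of_bounded (M := 1 / 2) (by simp) ?_ ?_
  · exact (measurable_sawtooth.comp (measurable_const.div measurable_id)).aestronglyMeasurable
  · exact Filter.Eventually.of_forall fun y => abs_sawtooth_le _

/-- The `L¹` modulus of continuity of `a ↦ (y ↦ sawtooth (a / y))`. Below the cutoff
`ε = √(b - a)` the integrand is bounded trivially; above it at most `b / ε` jumps occur, each
contributing a set of measure at most `(b - a) / a`. -/
theorem integral_abs_sawtooth_sub_le {a b : ℝ} (ha : 1 ≤ a) (hab : a ≤ b) (hb : b ≤ a + 1) :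
    ∫ y in Ioc (0 : ℝ) 1, |sawtooth (a / y) - sawtooth (b / y)| ≤ 4 * √(b - a) := by
  rcases hab.eq_or_lt with rfl | hlt
  · simp
  set ε := √(b - a) with hεdef
  have hε : 0 < ε := Real.sqrt_pos.2 (sub_pos.2 hlt)
  have hεsq : b - a = ε * ε := (Real.mul_self_sqrt (sub_nonneg.2 hab)).symm
  have hind : ∀ s : Set ℝ, MeasurableSet s →
      IntegrableOn (s.indicator (fun _ => (1 : ℝ))) (Ioc 0 1) := fun s hs =>
    (integrableOn_const (by simp)).indicator hs
  have hI1 := hind (Ioc 0 ε) measurableSet_Ioc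
  have hI2 : IntegrableOn (fun _ : ℝ => (b - a) / ε) (Ioc 0 1) := integrableOn_const (by simp)
  have hI3 : IntegrableOn (fun y : ℝ => ∑ m ∈ Finset.Icc ⌈a⌉₊ ⌊b / ε⌋₊,
      (Icc (a / m) (b / m)).indicator (fun _ => (1 : ℝ)) y) (Ioc 0 1) :=
    integrable_finsetSum _ fun m _ => hind _ measurableSet_Icc
  have hmono := setIntegral_mono_on
    (((integrableOn_sawtooth_div a).sub (integrableOn_sawtooth_div b)).norm)
    ((hI1.add hI2).add hI3) measurableSet_Ioc
    (fun y hy => abs_sawtooth_div_sub_le ha hab hε hy)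
  refine le_trans hmono ?_
  have e1 := integral_add (hI1.add hI2) hI3
  have e2 := integral_add hI1 hI2
  simp only [Pi.add_apply] at e1 e2 ⊢
  rw [e1, e2]
  have b1 : ∫ y in Ioc (0 : ℝ) 1, (Ioc 0 ε).indicator (fun _ => (1 : ℝ)) y ≤ ε - 0 :=
    setIntegral_Ioc_indicator_one_le _ measurableSet_Ioc Ioc_subset_Icc_self hε.le
  have b2 : ∫ _ in Ioc (0 : ℝ) 1, (b - a) / ε = ε := by
    rw [setIntegral_const, hεsq]
    simp
  have b3 : ∫ y in Ioc (0 : ℝ) 1, ∑ m ∈ Finset.Icc ⌈a⌉₊ ⌊b / ε⌋₊,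
      (Icc (a / m) (b / m)).indicator (fun _ => (1 : ℝ)) y ≤ 2 * ε := by
    rw [integral_finsetSum _ fun m _ => hind _ measurableSet_Icc]
    have hterm : ∀ m ∈ Finset.Icc ⌈a⌉₊ ⌊b / ε⌋₊,
        ∫ y in Ioc (0 : ℝ) 1, (Icc (a / (m : ℝ)) (b / m)).indicator (fun _ => (1 : ℝ)) y
          ≤ (b - a) / a := by
      intro m hm
      have ham : a ≤ m := Nat.ceil_le.1 (Finset.mem_Icc.1 hm).1
      refine (setIntegral_Ioc_indicator_one_le _ measurableSet_Icc subset_rfl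
        (div_le_div_of_nonneg_right hab (by linarith))).trans ?_
      rw [← sub_div]
      exact div_le_div_of_nonneg_left (sub_nonneg.2 hab) (by linarith) ham
    refine (Finset.sum_le_sum hterm).trans ?_
    rw [Finset.sum_const, nsmul_eq_mul, Nat.card_Icc]
    have hc : ((⌊b / ε⌋₊ + 1 - ⌈a⌉₊ : ℕ) : ℝ) ≤ b / ε := by
      have h1 : 1 ≤ ⌈a⌉₊ := Nat.one_le_ceil_iff.2 (by linarith)
      have h2 : ⌊b / ε⌋₊ + 1 - ⌈a⌉₊ ≤ ⌊b / ε⌋₊ := by omega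
      exact le_trans (by exact_mod_cast h2) (Nat.floor_le (div_nonneg (by linarith) hε.le))
    have ha0 : 0 < a := by linarith
    refine (mul_le_mul_of_nonneg_right hc (div_nonneg (sub_nonneg.2 hab) ha0.le)).trans ?_
    rw [hεsq, div_mul_div_comm, div_le_iff₀ (by positivity)]
    have : b ≤ 2 * a := by linarith
    nlinarith [mul_pos hε hε]
  linarith

/-! ### Boundedness and Hölder continuity of eigenfunctions -/

namespace IsKernelEigenfunction

variable {φ : ℝ → ℝ} {lam : ℝ}

theorem integrableOn (hφ : IsKernelEigenfunction φ lam) : IntegrableOn φ (Ioc 0 1) :=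
  IntegrableOn.mono_set (hφ.memLp.integrable one_le_two) Ioc_subset_Icc_self

theorem eq_integral_sawtooth (hφ : IsKernelEigenfunction φ lam) {x : ℝ} (hx : x ∈ Ioc (0 : ℝ) 1) :
    φ x = lam * ∫ y in Ioc (0 : ℝ) 1, sawtooth (x⁻¹ / y) * φ y := by
  rw [hφ.eigen x ⟨hx.1.le, hx.2⟩, intervalIntegral.integral_of_le zero_le_one]
  congr 1
  refine setIntegral_congr_fun measurableSet_Ioc fun y hy => ?_
  simp only [fractKernel, sawtooth, if_pos (And.intro hx.1 hy.1), mul_inv, div_eq_mul_inv]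

theorem integrableOn_sawtooth_mul (hφ : IsKernelEigenfunction φ lam) (a : ℝ) :
    IntegrableOn (fun y => sawtooth (a / y) * φ y) (Ioc 0 1) :=
  hφ.integrableOn.bdd_mul (c := 1 / 2) (integrableOn_sawtooth_div a).aestronglyMeasurable
    (Filter.Eventually.of_forall fun _ => abs_sawtooth_le _)

theorem lam_ne_zero (hφ : IsKernelEigenfunction φ lam) : lam ≠ 0 := by
  rintro rfl
  have h := hφ.norm_pos
  rw [intervalIntegral.integral_congr (g := fun _ => (0 : ℝ))] at h
  · simp at h
  · intro x hx
    rw [uIcc_of_le zero_le_one] at hx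
    simp [hφ.eigen x hx]

theorem exists_bound (hφ : IsKernelEigenfunction φ lam) :
    ∃ M : ℝ, 0 ≤ M ∧ ∀ x ∈ Ioc (0 : ℝ) 1, |φ x| ≤ M := by
  refine ⟨|lam| * ∫ y in Ioc (0 : ℝ) 1, |φ y|,
    mul_nonneg (abs_nonneg _) (integral_nonneg fun _ => abs_nonneg _), fun x hx => ?_⟩
  rw [hφ.eq_integral_sawtooth hx, abs_mul]
  refine mul_le_mul_of_nonneg_left ?_ (abs_nonneg _)
  rw [← Real.norm_eq_abs]
  refine norm_integral_le_of_norm_le hφ.integrableOn.norm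
    (Filter.Eventually.of_forall fun y => ?_)
  rw [norm_mul]
  have := abs_sawtooth_le (x⁻¹ / y)
  simp only [Real.norm_eq_abs]
  nlinarith [abs_nonneg (φ y)]

/-- An eigenfunction is Hölder continuous of order `1/2` in the variable `a = 1/x`. -/
theorem exists_holder (hφ : IsKernelEigenfunction φ lam) :
    ∃ C : ℝ, 0 ≤ C ∧ ∀ a b : ℝ, 1 ≤ a → 1 ≤ b → |a - b| ≤ 1 →
      |φ a⁻¹ - φ b⁻¹| ≤ C * √|a - b| := by
  obtain ⟨M, hM0, hM⟩ := hφ.exists_bound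
  have key : ∀ a b : ℝ, 1 ≤ a → a ≤ b → b ≤ a + 1 →
      |φ a⁻¹ - φ b⁻¹| ≤ (|lam| * (4 * M)) * √(b - a) := by
    intro a b ha hab hb
    have hmem : ∀ c : ℝ, 1 ≤ c → c⁻¹ ∈ Ioc (0 : ℝ) 1 := fun c hc =>
      ⟨by positivity, inv_le_one_of_one_le₀ hc⟩
    rw [hφ.eq_integral_sawtooth (hmem a ha), hφ.eq_integral_sawtooth (hmem b (ha.trans hab)),
      inv_inv, inv_inv, ← mul_sub, abs_mul, mul_assoc,
      ← integral_sub (hφ.integrableOn_sawtooth_mul a) (hφ.integrableOn_sawtooth_mul b)]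
    refine mul_le_mul_of_nonneg_left ?_ (abs_nonneg _)
    have hI : IntegrableOn (fun y => |sawtooth (a / y) - sawtooth (b / y)|) (Ioc 0 1) :=
      ((integrableOn_sawtooth_div a).sub (integrableOn_sawtooth_div b)).norm
    have h1 : ‖∫ y in Ioc (0 : ℝ) 1, (sawtooth (a / y) * φ y - sawtooth (b / y) * φ y)‖ ≤
        ∫ y in Ioc (0 : ℝ) 1, |sawtooth (a / y) - sawtooth (b / y)| * M := by
      refine norm_integral_le_of_norm_le (hI.mul_const M) ?_
      filter_upwards [ae_restrict_mem measurableSet_Ioc] with y hy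
      rw [← sub_mul, norm_mul]
      exact mul_le_mul_of_nonneg_left (hM y hy) (abs_nonneg _)
    refine h1.trans ?_
    rw [integral_mul_const]
    nlinarith [integral_abs_sawtooth_sub_le ha hab hb]
  refine ⟨|lam| * (4 * M), by positivity, fun a b ha hb h => ?_⟩
  rcases le_total a b with hab | hab
  · rw [abs_sub_comm a b, abs_of_nonneg (sub_nonneg.2 hab)] at *
    exact key a b ha hab (by linarith)
  · rw [abs_of_nonneg (sub_nonneg.2 hab)] at *
    rw [abs_sub_comm]
    exact key b a hb hab (by linarith)

end IsKernelEigenfunction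

/-! ### Decay of eigenfunctions at zero -/

theorem intervalIntegrable_sawtooth_mul {a c d : ℝ} (hcd : c ≤ d) {g : ℝ → ℝ}
    (hg : ContinuousOn g (Icc c d)) :
    IntervalIntegrable (fun u => sawtooth (a * u) * g u) volume c d := by
  rw [intervalIntegrable_iff_integrableOn_Icc_of_le hcd]
  exact (hg.integrableOn_Icc).bdd_mul (c := 1 / 2)
    (measurable_sawtooth.comp (measurable_const.mul measurable_id)).aestronglyMeasurable
    (Filter.Eventually.of_forall fun _ => abs_sawtooth_le _)

theorem integral_sawtooth_mul_period {a : ℝ} (ha : 0 < a) (c : ℝ) :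
    ∫ u in c..(c + 1 / a), sawtooth (a * u) = 0 := by
  rw [intervalIntegral.integral_comp_mul_left _ ha.ne',
    show a * (c + 1 / a) = a * c + 1 by field_simp,
    sawtooth_periodic.intervalIntegral_add_eq (a * c) 0, zero_add, integral_sawtooth, smul_zero]

/-- Cancellation of the sawtooth against a Hölder function: on each of the `N` periods, which
have length `1 / a`, the function may be replaced by its increment. -/
theorem abs_integral_sawtooth_mul_le {a L : ℝ} {g : ℝ → ℝ} (ha : 1 ≤ a) (hL0 : 0 ≤ L)
    (hg : ContinuousOn g (Ici 1))
    (hL : ∀ u v : ℝ, 1 ≤ u → 1 ≤ v → |u - v| ≤ 1 → |g u - g v| ≤ L * √|u - v|) (N : ℕ) :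
    |∫ u in (1 : ℝ)..(1 + N / a), sawtooth (a * u) * g u| ≤ N / a * (L * √(1 / a)) := by
  have ha0 : 0 < a := by linarith
  have hint : ∀ c d : ℝ, 1 ≤ c → c ≤ d →
      IntervalIntegrable (fun u => sawtooth (a * u) * g u) volume c d := fun c d hc hcd =>
    intervalIntegrable_sawtooth_mul hcd (hg.mono fun u hu => hc.trans hu.1)
  induction N with
  | zero => simp
  | succ N ih =>
    set c : ℝ := 1 + N / a with hc
    have hc1 : 1 ≤ c := by
      have : 0 ≤ (N : ℝ) / a := by positivity
      linarith
    have hend : 1 + ((N + 1 : ℕ) : ℝ) / a = c + 1 / a := by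
      rw [hc]; push_cast; ring
    have hpos : 0 < 1 / a := by positivity
    have hone : 1 / a ≤ 1 := by rw [div_le_one ha0]; exact ha
    have hstep : |∫ u in c..(c + 1 / a), sawtooth (a * u) * g u| ≤ 1 / a * (L * √(1 / a)) := by
      have hconst : IntervalIntegrable (fun u => sawtooth (a * u) * g c) volume c (c + 1 / a) :=
        intervalIntegrable_sawtooth_mul (by linarith) continuousOn_const
      have heq : ∫ u in c..(c + 1 / a), sawtooth (a * u) * g u =
          ∫ u in c..(c + 1 / a), sawtooth (a * u) * (g u - g c) := by
        simp_rw [mul_sub]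
        rw [intervalIntegral.integral_sub (hint c _ hc1 (by linarith)) hconst,
          intervalIntegral.integral_mul_const, integral_sawtooth_mul_period ha0, zero_mul, sub_zero]
      rw [heq]
      have := intervalIntegral.norm_integral_le_of_norm_le_const (a := c) (b := c + 1 / a)
        (f := fun u => sawtooth (a * u) * (g u - g c)) (C := L * √(1 / a)) ?_
      · rw [add_sub_cancel_left, abs_of_pos hpos, mul_comm] at this
        exact this
      · intro u hu
        rw [uIoc_of_le (by linarith)] at hu
        have huc : |u - c| ≤ 1 / a := by
          rw [abs_of_pos (sub_pos.2 hu.1)]; linarith [hu.2]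
        have h1 := hL u c (hc1.trans hu.1.le) hc1 (huc.trans hone)
        have h2 : L * √|u - c| ≤ L * √(1 / a) :=
          mul_le_mul_of_nonneg_left (Real.sqrt_le_sqrt huc) hL0
        have h3 := abs_sawtooth_le (a * u)
        rw [norm_mul, Real.norm_eq_abs, Real.norm_eq_abs]
        nlinarith [abs_nonneg (g u - g c), abs_nonneg (sawtooth (a * u))]
    rw [hend, ← intervalIntegral.integral_add_adjacent_intervals (hint 1 c le_rfl hc1)
      (hint c _ hc1 (by linarith))]
    refine (abs_add_le _ _).trans ((add_le_add ih hstep).trans (le_of_eq ?_))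
    push_cast
    ring

/-- The substitution `y = 1 / u`. -/
theorem setIntegral_inv_Ioc {U : ℝ} (hU : 1 ≤ U) (F : ℝ → ℝ) :
    ∫ y in Ioc U⁻¹ 1, F y = ∫ u in (1 : ℝ)..U, F u⁻¹ * (u ^ 2)⁻¹ := by
  have hU0 : 0 < U := by linarith
  have himg : (fun u : ℝ => u⁻¹) '' Icc 1 U = Icc U⁻¹ 1 := by
    ext y
    constructor
    · rintro ⟨u, hu, rfl⟩
      have : 0 < u := by linarith [hu.1]
      exact ⟨inv_anti₀ this hu.2, inv_le_one_of_one_le₀ hu.1⟩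
    · intro hy
      have h0 : 0 < y := (inv_pos.2 hU0).trans_le hy.1
      exact ⟨y⁻¹, ⟨(one_le_inv₀ h0).2 hy.2, inv_le_of_inv_le₀ hU0 hy.1⟩, inv_inv y⟩
  rw [← integral_Icc_eq_integral_Ioc, ← himg,
    integral_image_eq_integral_abs_deriv_smul (f' := fun u => -(u ^ 2)⁻¹) measurableSet_Icc
      (fun u hu => (hasDerivAt_inv (by linarith [hu.1])).hasDerivWithinAt)
      (fun u _ v _ h => inv_injective h),
    intervalIntegral.integral_of_le hU, ← integral_Icc_eq_integral_Ioc]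
  refine setIntegral_congr_fun measurableSet_Icc fun u _ => ?_
  simp only [abs_neg, smul_eq_mul]
  rw [abs_of_nonneg (by positivity), mul_comm]

namespace IsKernelEigenfunction

variable {φ : ℝ → ℝ} {lam : ℝ}

theorem continuousOn_comp_inv (hφ : IsKernelEigenfunction φ lam) :
    ContinuousOn (fun a => φ a⁻¹) (Ici 1) := by
  obtain ⟨C, -, hC⟩ := hφ.exists_holder
  intro a ha
  rw [ContinuousWithinAt, tendsto_iff_dist_tendsto_zero]
  have hlim : Filter.Tendsto (fun b : ℝ => C * √|b - a|) (nhdsWithin a (Ici 1)) (nhds 0) := by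
    have : Continuous fun b : ℝ => C * √|b - a| := by fun_prop
    simpa using (this.tendsto a).mono_left nhdsWithin_le_nhds
  refine squeeze_zero' (Filter.Eventually.of_forall fun _ => dist_nonneg) ?_ hlim
  have hnear : ∀ᶠ b in nhdsWithin a (Ici 1), |b - a| < 1 :=
    nhdsWithin_le_nhds (Metric.ball_mem_nhds a one_pos)
  filter_upwards [hnear, self_mem_nhdsWithin] with b hb hb1
  exact hC b a hb1 ha hb.le

theorem continuousOn (hφ : IsKernelEigenfunction φ lam) : ContinuousOn φ (Ioc 0 1) := by
  have h : ContinuousOn (fun x : ℝ => φ (x⁻¹)⁻¹) (Ioc 0 1) :=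
    ContinuousOn.comp (g := fun a => φ a⁻¹) (f := fun x : ℝ => x⁻¹) hφ.continuousOn_comp_inv
      (continuousOn_id.inv₀ fun x hx => hx.1.ne') fun x hx => (one_le_inv₀ hx.1).2 hx.2
  simpa only [inv_inv] using h

/-- The Hölder bound, transported to the density `u ↦ φ (1/u) / u ^ 2` that arises from the
substitution `y = 1/u`. -/
theorem exists_holder_density (hφ : IsKernelEigenfunction φ lam) :
    ∃ L : ℝ, 0 ≤ L ∧ ∀ u v : ℝ, 1 ≤ u → 1 ≤ v → |u - v| ≤ 1 →
      |φ u⁻¹ * (u ^ 2)⁻¹ - φ v⁻¹ * (v ^ 2)⁻¹| ≤ L * √|u - v| := by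
  obtain ⟨C, hC0, hC⟩ := hφ.exists_holder
  obtain ⟨M, hM0, hM⟩ := hφ.exists_bound
  refine ⟨C + 2 * M, by positivity, fun u v hu hv huv => ?_⟩
  have hu0 : 0 < u := by linarith
  have hv0 : 0 < v := by linarith
  have h1 : |(u ^ 2)⁻¹ - (v ^ 2)⁻¹| ≤ 2 * √|u - v| := by
    have hs : |u - v| ≤ √|u - v| := Real.le_sqrt_of_sq_le (by nlinarith [abs_nonneg (u - v)])
    have he : (u ^ 2)⁻¹ - (v ^ 2)⁻¹ = -(u - v) * ((u + v) / (u ^ 2 * v ^ 2)) := by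
      field_simp; ring
    have hq : (u + v) / (u ^ 2 * v ^ 2) ≤ 2 := by
      rw [div_le_iff₀ (by positivity)]
      have hu2 : u ≤ u ^ 2 := by nlinarith
      have hv2 : v ≤ v ^ 2 := by nlinarith
      nlinarith
    rw [he, abs_mul, abs_neg, abs_of_pos (show 0 < (u + v) / (u ^ 2 * v ^ 2) by positivity)]
    nlinarith [abs_nonneg (u - v)]
  have h2 := hC u v hu hv huv
  have h3 := hM v⁻¹ ⟨by positivity, inv_le_one_of_one_le₀ hv⟩
  have h4 : (u ^ 2)⁻¹ ≤ 1 := inv_le_one_of_one_le₀ (by nlinarith)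
  have h5 : 0 ≤ (u ^ 2)⁻¹ := by positivity
  rw [show φ u⁻¹ * (u ^ 2)⁻¹ - φ v⁻¹ * (v ^ 2)⁻¹ =
    (φ u⁻¹ - φ v⁻¹) * (u ^ 2)⁻¹ + φ v⁻¹ * ((u ^ 2)⁻¹ - (v ^ 2)⁻¹) by ring]
  refine (abs_add_le _ _).trans ?_
  rw [abs_mul, abs_mul, abs_of_nonneg h5]
  have h6 : |φ u⁻¹ - φ v⁻¹| * (u ^ 2)⁻¹ ≤ C * √|u - v| :=
    (mul_le_of_le_one_right (abs_nonneg _) h4).trans h2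
  have h7 : |φ v⁻¹| * |(u ^ 2)⁻¹ - (v ^ 2)⁻¹| ≤ M * (2 * √|u - v|) :=
    mul_le_mul h3 h1 (abs_nonneg _) hM0
  linarith

/-- Decay of an eigenfunction at `0`. Put `q = x ^ (-1/4)`. The part of the integral over
`y ≤ 1/U`, where `q ≤ U ≤ 1 + 2 q`, is small because `φ` is bounded; the rest is small because the
sawtooth, of period `q ^ (-4)` in `u = 1/y`, cancels against a Hölder function on the range
`1 ≤ u ≤ U`. The number `N` of periods is chosen so that `U = 1 + N / q ^ 4` is of this size. -/
theorem exists_decay (hφ : IsKernelEigenfunction φ lam) :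
    ∃ C : ℝ, 0 ≤ C ∧ ∀ x ∈ Ioc (0 : ℝ) 1, |φ x| ≤ C * x ^ (1 / 4 : ℝ) := by
  obtain ⟨M, hM0, hM⟩ := hφ.exists_bound
  obtain ⟨L, hL0, hL⟩ := hφ.exists_holder_density
  refine ⟨|lam| * (M + 2 * L), by positivity, fun x hx => ?_⟩
  set q : ℝ := (x ^ (1 / 4 : ℝ))⁻¹ with hqdef
  have hxq : x ^ (1 / 4 : ℝ) = q⁻¹ := (inv_inv _).symm
  have hq0 : 0 < q := inv_pos.2 (Real.rpow_pos_of_pos hx.1 _)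
  have hq4 : x⁻¹ = q ^ 4 := by
    rw [hqdef, inv_pow, ← Real.rpow_natCast, ← Real.rpow_mul hx.1.le]
    norm_num
  have hq1 : 1 ≤ q :=
    (one_le_inv₀ (Real.rpow_pos_of_pos hx.1 _)).2 (Real.rpow_le_one hx.1.le hx.2 (by norm_num))
  have ha : 1 ≤ q ^ 4 := one_le_pow₀ hq1
  have hsq : √(1 / q ^ 4) = (q ^ 2)⁻¹ := by
    rw [show 1 / q ^ 4 = ((q ^ 2)⁻¹) ^ 2 by field_simp, Real.sqrt_sq (by positivity)]
  set N : ℕ := ⌈q ^ 5⌉₊ with hN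
  have hN1 : q ^ 5 ≤ N := Nat.le_ceil _
  have hN2 : (N : ℝ) ≤ 2 * q ^ 5 := by
    have h1 : (N : ℝ) < q ^ 5 + 1 := Nat.ceil_lt_add_one (by positivity)
    have h2 : 1 ≤ q ^ 5 := one_le_pow₀ hq1
    linarith
  have hNq1 : q ≤ N / q ^ 4 := by rw [le_div_iff₀ (by positivity)]; linarith [pow_succ q 4]
  have hNq2 : N / q ^ 4 ≤ 2 * q := by rw [div_le_iff₀ (by positivity)]; linarith [pow_succ q 4]
  set U : ℝ := 1 + N / q ^ 4 with hU
  have hU1 : 1 ≤ U := by linarith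
  have hUq : q ≤ U := by linarith
  have hUi : U⁻¹ ∈ Ioc (0 : ℝ) 1 := ⟨by positivity, inv_le_one_of_one_le₀ hU1⟩
  have hint := hφ.integrableOn_sawtooth_mul (q ^ 4)
  have hsplit : ∫ y in Ioc (0 : ℝ) 1, sawtooth (q ^ 4 / y) * φ y =
      (∫ y in Ioc 0 U⁻¹, sawtooth (q ^ 4 / y) * φ y) +
        ∫ y in Ioc U⁻¹ 1, sawtooth (q ^ 4 / y) * φ y := by
    rw [← setIntegral_union (Ioc_disjoint_Ioc_of_le le_rfl) measurableSet_Ioc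
      (hint.mono_set (Ioc_subset_Ioc_right hUi.2)) (hint.mono_set (Ioc_subset_Ioc_left hUi.1.le)),
      Ioc_union_Ioc_eq_Ioc hUi.1.le hUi.2]
  have hb1 : |∫ y in Ioc 0 U⁻¹, sawtooth (q ^ 4 / y) * φ y| ≤ M * q⁻¹ := by
    have := norm_setIntegral_le_of_norm_le_const (μ := volume) (s := Ioc 0 U⁻¹) (C := M)
      (f := fun y => sawtooth (q ^ 4 / y) * φ y) (by simp) ?_
    · refine this.trans (mul_le_mul_of_nonneg_left ?_ hM0)
      rw [Real.volume_real_Ioc_of_le hUi.1.le, sub_zero]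
      exact inv_anti₀ hq0 hUq
    · intro y hy
      have h1 := abs_sawtooth_le (q ^ 4 / y)
      have h2 := hM y ⟨hy.1, hy.2.trans hUi.2⟩
      rw [norm_mul, Real.norm_eq_abs, Real.norm_eq_abs]
      nlinarith [abs_nonneg (φ y)]
  have hb2 : |∫ y in Ioc U⁻¹ 1, sawtooth (q ^ 4 / y) * φ y| ≤ 2 * L * q⁻¹ := by
    rw [setIntegral_inv_Ioc hU1]
    have hcont : ContinuousOn (fun u : ℝ => φ u⁻¹ * (u ^ 2)⁻¹) (Ici 1) :=
      hφ.continuousOn_comp_inv.mul ((continuousOn_id.pow 2).inv₀ fun u hu => by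
        have : (0 : ℝ) < u := one_pos.trans_le hu
        exact pow_ne_zero 2 this.ne')
    have h := abs_integral_sawtooth_mul_le ha hL0 hcont hL N
    rw [hsq] at h
    simp only [div_inv_eq_mul, mul_assoc] at h ⊢
    refine h.trans ((mul_le_mul_of_nonneg_right hNq2 (by positivity)).trans (le_of_eq ?_))
    field_simp
  rw [hφ.eq_integral_sawtooth hx, hq4, hsplit, hxq, abs_mul, mul_assoc]
  refine mul_le_mul_of_nonneg_left ((abs_add_le _ _).trans ?_) (abs_nonneg _)
  linarith

end IsKernelEigenfunction

/-! ### The series expansion of an eigenfunction -/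

/-- The function `φ` on `(0, 1]`, continued to the right of `1` by the constant `φ 1`. -/
def extendRight (φ : ℝ → ℝ) (t : ℝ) : ℝ := φ (min t 1)

/-- The primitive `t ↦ ∫₀ᵗ` of `extendRight φ`. -/
noncomputable def primitiveRight (φ : ℝ → ℝ) (t : ℝ) : ℝ := ∫ s in (0 : ℝ)..t, extendRight φ s

theorem extendRight_of_le {φ : ℝ → ℝ} {t : ℝ} (ht : t ≤ 1) : extendRight φ t = φ t := by
  rw [extendRight, min_eq_left ht]

theorem extendRight_of_ge {φ : ℝ → ℝ} {t : ℝ} (ht : 1 ≤ t) : extendRight φ t = φ 1 := by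
  rw [extendRight, min_eq_right ht]

theorem summable_succ_rpow_mul :
    Summable fun k : ℕ => (((k : ℝ) + 1)⁻¹) ^ (1 / 4 : ℝ) * ((k : ℝ) + 1)⁻¹ := by
  have h := (summable_nat_add_iff 1).2
    (Real.summable_nat_rpow_inv.2 (show (1 : ℝ) < 5 / 4 by norm_num))
  refine h.congr fun k => ?_
  have hk : (0 : ℝ) < (k : ℝ) + 1 := by positivity
  rw [← Real.rpow_add_one (inv_ne_zero hk.ne'), Real.inv_rpow hk.le]
  push_cast
  norm_num

namespace IsKernelEigenfunction

variable {φ : ℝ → ℝ} {lam : ℝ}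

theorem continuousOn_extendRight (hφ : IsKernelEigenfunction φ lam) :
    ContinuousOn (extendRight φ) (Ioi 0) :=
  hφ.continuousOn.comp (f := fun t : ℝ => min t 1) (by fun_prop)
    fun _ ht => ⟨lt_min ht one_pos, min_le_right _ _⟩

theorem abs_extendRight_le {C : ℝ} (hC0 : 0 ≤ C)
    (hC : ∀ x ∈ Ioc (0 : ℝ) 1, |φ x| ≤ C * x ^ (1 / 4 : ℝ)) {t : ℝ} (ht : 0 < t) :
    |extendRight φ t| ≤ C * t ^ (1 / 4 : ℝ) :=
  (hC _ ⟨lt_min ht one_pos, min_le_right _ _⟩).trans (mul_le_mul_of_nonneg_left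
    (Real.rpow_le_rpow (le_min ht.le zero_le_one) (min_le_left _ _) (by norm_num)) hC0)

theorem intervalIntegrable_extendRight (hφ : IsKernelEigenfunction φ lam) {t : ℝ} (ht : 0 ≤ t) :
    IntervalIntegrable (extendRight φ) volume 0 t := by
  obtain ⟨M, -, hM⟩ := hφ.exists_bound
  rw [intervalIntegrable_iff_integrableOn_Ioc_of_le ht]
  refine Integrable.mono' (g := fun _ => M) (integrableOn_const (by simp))
    ((hφ.continuousOn_extendRight.mono fun s hs => hs.1).aestronglyMeasurable
      measurableSet_Ioc) ?_
  filter_upwards [ae_restrict_mem measurableSet_Ioc] with s hs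
  exact hM _ ⟨lt_min hs.1 one_pos, min_le_right _ _⟩

theorem hasDerivAt_primitiveRight (hφ : IsKernelEigenfunction φ lam) {t : ℝ} (ht : 0 < t) :
    HasDerivAt (primitiveRight φ) (extendRight φ t) t :=
  intervalIntegral.integral_hasDerivAt_right (hφ.intervalIntegrable_extendRight ht.le)
    (hφ.continuousOn_extendRight.stronglyMeasurableAtFilter isOpen_Ioi t ht)
    (hφ.continuousOn_extendRight.continuousAt (Ioi_mem_nhds ht))

theorem abs_primitiveRight_le {C : ℝ} (hC0 : 0 ≤ C)
    (hC : ∀ x ∈ Ioc (0 : ℝ) 1, |φ x| ≤ C * x ^ (1 / 4 : ℝ)) {t : ℝ} (ht : 0 < t) :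
    |primitiveRight φ t| ≤ C * t ^ (1 / 4 : ℝ) * t := by
  have := intervalIntegral.norm_integral_le_of_norm_le_const (a := 0) (b := t)
    (f := extendRight φ) (C := C * t ^ (1 / 4 : ℝ)) ?_
  · rwa [sub_zero, abs_of_pos ht] at this
  · intro s hs
    rw [uIoc_of_le ht.le] at hs
    exact (abs_extendRight_le hC0 hC hs.1).trans (mul_le_mul_of_nonneg_left
      (Real.rpow_le_rpow hs.1.le hs.2 (by norm_num)) hC0)

theorem setIntegral_eq_primitiveRight (hφ : IsKernelEigenfunction φ lam) {t : ℝ} (ht : 0 < t) :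
    ∫ y in Ioc (0 : ℝ) 1, (Iic t).indicator φ y = primitiveRight φ t - φ 1 * max (t - 1) 0 := by
  rw [setIntegral_indicator measurableSet_Iic, Ioc_inter_Iic]
  have h1 : ∀ s : ℝ, 0 ≤ s → s ≤ 1 → ∫ y in Ioc (0 : ℝ) s, φ y = primitiveRight φ s := by
    intro s hs0 hs
    rw [primitiveRight, intervalIntegral.integral_of_le hs0]
    exact setIntegral_congr_fun measurableSet_Ioc fun y hy =>
      (extendRight_of_le (hy.2.trans hs)).symm
  rcases le_total t 1 with h | h
  · rw [min_eq_right h, h1 t ht.le h, max_eq_right (by linarith), mul_zero, sub_zero]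
  · rw [min_eq_left h, h1 1 zero_le_one le_rfl, max_eq_left (by linarith), eq_sub_iff_add_eq]
    have h2 : φ 1 * (t - 1) = ∫ s in (1 : ℝ)..t, extendRight φ s := by
      rw [intervalIntegral.integral_congr (g := fun _ => φ 1)]
      · simp [mul_comm]
      · intro s hs
        rw [uIcc_of_le h] at hs
        exact extendRight_of_ge hs.1
    rw [h2]
    exact intervalIntegral.integral_add_adjacent_intervals
      (hφ.intervalIntegrable_extendRight zero_le_one)
      ((hφ.intervalIntegrable_extendRight zero_le_one).symm.trans
        (hφ.intervalIntegrable_extendRight ht.le))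

theorem integrableOn_div (hφ : IsKernelEigenfunction φ lam) :
    IntegrableOn (fun y => φ y / y) (Ioc 0 1) := by
  obtain ⟨C, -, hC⟩ := hφ.exists_decay
  have hdom : IntegrableOn (fun y : ℝ => C * y ^ (-3 / 4 : ℝ)) (Ioc 0 1) := by
    have h := (intervalIntegral.intervalIntegrable_rpow' (a := 0) (b := 1)
      (show (-1 : ℝ) < -3 / 4 by norm_num)).const_mul C
    rwa [intervalIntegrable_iff_integrableOn_Ioc_of_le zero_le_one] at h
  refine Integrable.mono' hdom ?_ ?_
  · simp only [div_eq_mul_inv]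
    exact hφ.integrableOn.aestronglyMeasurable.mul measurable_inv.aestronglyMeasurable
  · filter_upwards [ae_restrict_mem measurableSet_Ioc] with y hy
    rw [norm_div, Real.norm_eq_abs, Real.norm_eq_abs, abs_of_pos hy.1, div_le_iff₀ hy.1, mul_assoc,
      ← Real.rpow_add_one hy.1.ne']
    refine (hC y hy).trans (le_of_eq ?_)
    norm_num

/-- Summation of the indicators of `{y ≤ 1 / (m x)}`, `m ≥ 1`, recovers the floor of `1 / (x y)`. -/
theorem hasSum_setIntegral_indicator (hφ : IsKernelEigenfunction φ lam) {x : ℝ} (hx : 0 < x) :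
    HasSum (fun k : ℕ => ∫ y in Ioc (0 : ℝ) 1, (Iic (((k : ℝ) + 1) * x)⁻¹).indicator φ y)
      (∫ y in Ioc (0 : ℝ) 1, (⌊x⁻¹ / y⌋₊ : ℝ) * φ y) := by
  obtain ⟨C, hC0, hC⟩ := hφ.exists_decay
  have h := hasSum_integral_of_summable_integral_norm (μ := volume.restrict (Ioc (0 : ℝ) 1))
    (F := fun (k : ℕ) y => (Iic (((k : ℝ) + 1) * x)⁻¹).indicator φ y)
    (fun k => hφ.integrableOn.indicator measurableSet_Iic) ?_
  · suffices hfloor : ∫ y in Ioc (0 : ℝ) 1, (⌊x⁻¹ / y⌋₊ : ℝ) * φ y =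
        ∫ y in Ioc (0 : ℝ) 1, ∑' k : ℕ, (Iic (((k : ℝ) + 1) * x)⁻¹).indicator φ y by
      rw [hfloor]
      exact h
    refine setIntegral_congr_fun measurableSet_Ioc fun y hy => ?_
    have hmem : ∀ k : ℕ, y ∈ Iic (((k : ℝ) + 1) * x)⁻¹ ↔ k ∈ Finset.range ⌊x⁻¹ / y⌋₊ := by
      intro k
      rw [Finset.mem_range, ← Nat.succ_le_iff, Nat.le_floor_iff (div_nonneg (by positivity) hy.1.le),
        mem_Iic, le_div_iff₀ hy.1, mul_inv, Nat.cast_succ, inv_mul_eq_div,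
        le_div_iff₀ (by positivity), mul_comm]
    rw [tsum_eq_sum (s := Finset.range ⌊x⁻¹ / y⌋₊)
      fun k hk => indicator_of_notMem (fun h => hk ((hmem k).1 h)) φ,
      Finset.sum_congr rfl fun k hk => indicator_of_mem ((hmem k).2 hk) φ]
    simp
  · refine Summable.of_nonneg_of_le (fun k => integral_nonneg fun _ => norm_nonneg _) (fun k => ?_)
      (summable_succ_rpow_mul.mul_left (C * (x⁻¹ ^ (1 / 4 : ℝ) * x⁻¹)))
    set t : ℝ := (((k : ℝ) + 1) * x)⁻¹ with ht
    have ht0 : 0 < t := by positivity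
    have hle : ∫ y in Ioc (0 : ℝ) 1, ‖(Iic t).indicator φ y‖ ≤ C * t ^ (1 / 4 : ℝ) * t := by
      simp_rw [norm_indicator_eq_indicator_norm]
      rw [setIntegral_indicator measurableSet_Iic, Ioc_inter_Iic]
      have hb := norm_setIntegral_le_of_norm_le_const (μ := volume) (s := Ioc 0 (min 1 t))
        (C := C * t ^ (1 / 4 : ℝ)) (f := fun y => ‖φ y‖) (by simp) ?_
      · refine (le_abs_self _).trans (hb.trans (mul_le_mul_of_nonneg_left ?_ (by positivity)))
        rw [Real.volume_real_Ioc_of_le (le_min zero_le_one ht0.le), sub_zero]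
        exact min_le_right _ _
      · intro y hy
        rw [norm_norm]
        exact (hC y ⟨hy.1, hy.2.trans (min_le_left _ _)⟩).trans (mul_le_mul_of_nonneg_left
          (Real.rpow_le_rpow hy.1.le (hy.2.trans (min_le_right _ _)) (by norm_num)) hC0)
    refine hle.trans (le_of_eq ?_)
    rw [ht, mul_inv, Real.mul_rpow (by positivity) (by positivity)]
    ring

/-- The expansion of the eigenvalue equation obtained from
`1/2 - {s} = 1/2 - s + ∑_{1 ≤ m ≤ s} 1`. -/
theorem eq_tsum_setIntegral (hφ : IsKernelEigenfunction φ lam) {x : ℝ} (hx : x ∈ Ioc (0 : ℝ) 1) :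
    φ x = lam * ((∫ y in Ioc (0 : ℝ) 1, φ y) / 2 - PhiOne φ * x⁻¹ +
      ∑' k : ℕ, ∫ y in Ioc (0 : ℝ) 1, (Iic (((k : ℝ) + 1) * x)⁻¹).indicator φ y) := by
  have hI1 : IntegrableOn (fun y => φ y / 2) (Ioc 0 1) := hφ.integrableOn.div_const 2
  have hI2 : IntegrableOn (fun y => φ y / y * x⁻¹) (Ioc 0 1) := hφ.integrableOn_div.mul_const _
  have hI3 : IntegrableOn (fun y => φ y / 2 - φ y / y * x⁻¹) (Ioc 0 1) := hI1.sub hI2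
  have hfloor : ∫ y in Ioc (0 : ℝ) 1, (⌊x⁻¹ / y⌋₊ : ℝ) * φ y =
      ∫ y in Ioc (0 : ℝ) 1, (sawtooth (x⁻¹ / y) * φ y - (φ y / 2 - φ y / y * x⁻¹)) := by
    refine setIntegral_congr_fun measurableSet_Ioc fun y hy => ?_
    rw [sawtooth, Int.fract, ← natCast_floor_eq_intCast_floor
      (div_nonneg (inv_nonneg.2 hx.1.le) hy.1.le)]
    ring
  rw [(hφ.hasSum_setIntegral_indicator hx.1).tsum_eq, hfloor,
    integral_sub (hφ.integrableOn_sawtooth_mul _) hI3, integral_sub hI1 hI2,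
    integral_mul_const, integral_div, PhiOne, intervalIntegral.integral_of_le zero_le_one,
    add_sub_cancel, hφ.eq_integral_sawtooth hx]

end IsKernelEigenfunction

/-! ### The continuously differentiable pieces -/

/-- The series `∑_{m ≥ 1} H (1 / (m x))` with `H = primitiveRight φ`, indexed by `m = k + 1`. -/
noncomputable def dilateSum (φ : ℝ → ℝ) (x : ℝ) : ℝ :=
  ∑' k : ℕ, primitiveRight φ (((k : ℝ) + 1) * x)⁻¹

/-- The series `∑_{m ≥ 1} φ (1 / (m x)) / m`, with `φ` continued constantly to the right of `1`;
it is `-x ^ 2` times the derivative of `dilateSum φ`. -/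
noncomputable def weightedDilateSum (φ : ℝ → ℝ) (x : ℝ) : ℝ :=
  ∑' k : ℕ, extendRight φ (((k : ℝ) + 1) * x)⁻¹ * ((k : ℝ) + 1)⁻¹

/-- The smooth function that agrees with the eigenfunction on `[1 / (n + 1), 1 / n]`. -/
noncomputable def smoothPiece (φ : ℝ → ℝ) (lam : ℝ) (n : ℕ) (x : ℝ) : ℝ :=
  lam * ((∫ y in Ioc (0 : ℝ) 1, φ y) / 2 - PhiOne φ * x⁻¹ +
    (dilateSum φ x - φ 1 * ∑ j ∈ Finset.range n, ((((j : ℝ) + 1) * x)⁻¹ - 1)))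

/-- The derivative of `smoothPiece φ lam n`. -/
noncomputable def smoothPieceDeriv (φ : ℝ → ℝ) (lam : ℝ) (n : ℕ) (x : ℝ) : ℝ :=
  lam * ((x ^ 2)⁻¹ * (PhiOne φ - weightedDilateSum φ x +
    φ 1 * ∑ j ∈ Finset.range n, ((j : ℝ) + 1)⁻¹))

theorem hasDerivAt_inv_const_mul {c x : ℝ} (hc : c ≠ 0) (hx : x ≠ 0) :
    HasDerivAt (fun x => (c * x)⁻¹) (-(x ^ 2)⁻¹ * c⁻¹) x := by
  have h := ((hasDerivAt_id x).const_mul c).inv (mul_ne_zero hc hx)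
  refine h.congr_deriv ?_
  simp only [id]
  field_simp

theorem contDiffOn_one_of_hasDerivAt {f f' : ℝ → ℝ} {s : Set ℝ} (hs : IsOpen s)
    (h : ∀ x ∈ s, HasDerivAt f (f' x) x) (hc : ContinuousOn f' s) : ContDiffOn ℝ 1 f s := by
  rw [show (1 : WithTop ℕ∞) = 0 + 1 by simp, contDiffOn_succ_iff_deriv_of_isOpen hs]
  refine ⟨fun x hx => (h x hx).differentiableAt.differentiableWithinAt, by simp, ?_⟩
  rw [contDiffOn_zero]
  exact hc.congr fun x hx => (h x hx).deriv

namespace IsKernelEigenfunction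

variable {φ : ℝ → ℝ} {lam : ℝ}

theorem abs_weightedDilateSum_term_le {C : ℝ} (hC0 : 0 ≤ C)
    (hC : ∀ x ∈ Ioc (0 : ℝ) 1, |φ x| ≤ C * x ^ (1 / 4 : ℝ)) {r x : ℝ} (hr : 0 < r) (hrx : r ≤ x)
    (k : ℕ) :
    ‖extendRight φ (((k : ℝ) + 1) * x)⁻¹ * ((k : ℝ) + 1)⁻¹‖ ≤
      C * r⁻¹ ^ (1 / 4 : ℝ) * ((((k : ℝ) + 1)⁻¹) ^ (1 / 4 : ℝ) * ((k : ℝ) + 1)⁻¹) := by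
  have hx : 0 < x := hr.trans_le hrx
  have h := abs_extendRight_le hC0 hC (show 0 < (((k : ℝ) + 1) * x)⁻¹ by positivity)
  have hk : (0 : ℝ) < ((k : ℝ) + 1)⁻¹ := by positivity
  rw [norm_mul, Real.norm_eq_abs, Real.norm_eq_abs, abs_of_pos hk, ← mul_assoc]
  refine mul_le_mul_of_nonneg_right (h.trans ?_) hk.le
  rw [mul_inv, Real.mul_rpow hk.le (by positivity), mul_assoc, mul_comm (r⁻¹ ^ _)]
  exact mul_le_mul_of_nonneg_left (mul_le_mul_of_nonneg_left (Real.rpow_le_rpow (by positivity)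
    (inv_anti₀ hr hrx) (by norm_num)) (by positivity)) hC0

theorem summable_weightedDilateSum (hφ : IsKernelEigenfunction φ lam) {x : ℝ} (hx : 0 < x) :
    Summable fun k : ℕ => extendRight φ (((k : ℝ) + 1) * x)⁻¹ * ((k : ℝ) + 1)⁻¹ := by
  obtain ⟨C, hC0, hC⟩ := hφ.exists_decay
  exact .of_norm_bounded (summable_succ_rpow_mul.mul_left _)
    (abs_weightedDilateSum_term_le hC0 hC hx le_rfl)

theorem summable_dilateSum (hφ : IsKernelEigenfunction φ lam) {x : ℝ} (hx : 0 < x) :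
    Summable fun k : ℕ => primitiveRight φ (((k : ℝ) + 1) * x)⁻¹ := by
  obtain ⟨C, hC0, hC⟩ := hφ.exists_decay
  refine .of_norm_bounded (summable_succ_rpow_mul.mul_left (C * (x⁻¹ ^ (1 / 4 : ℝ) * x⁻¹)))
    fun k => (abs_primitiveRight_le hC0 hC (by positivity)).trans (le_of_eq ?_)
  rw [mul_inv, Real.mul_rpow (by positivity) (by positivity)]
  ring

theorem continuousOn_weightedDilateSum (hφ : IsKernelEigenfunction φ lam) :
    ContinuousOn (weightedDilateSum φ) (Ioi 0) := by
  obtain ⟨C, hC0, hC⟩ := hφ.exists_decay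
  intro x hx
  have hx0 : 0 < x := hx
  have h : ContinuousOn (weightedDilateSum φ) (Ioi (x / 2)) := by
    refine continuousOn_tsum (fun k => ?_) (summable_succ_rpow_mul.mul_left _)
      fun k y hy => abs_weightedDilateSum_term_le hC0 hC (half_pos hx0) (le_of_lt hy) k
    refine ContinuousOn.mul ?_ continuousOn_const
    have hpos : ∀ y ∈ Ioi (x / 2), 0 < ((k : ℝ) + 1) * y := fun y hy =>
      mul_pos (by positivity) ((half_pos hx0).trans hy)
    exact hφ.continuousOn_extendRight.comp (f := fun y => (((k : ℝ) + 1) * y)⁻¹)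
      ((continuousOn_const.mul continuousOn_id).inv₀ fun y hy => (hpos y hy).ne')
      fun y hy => inv_pos.2 (hpos y hy)
  exact (h.continuousAt (Ioi_mem_nhds (half_lt_self hx0))).continuousWithinAt

theorem hasDerivAt_dilateSum (hφ : IsKernelEigenfunction φ lam) {x : ℝ} (hx : 0 < x) :
    HasDerivAt (dilateSum φ) (-(x ^ 2)⁻¹ * weightedDilateSum φ x) x := by
  obtain ⟨C, hC0, hC⟩ := hφ.exists_decay
  rw [weightedDilateSum, ← tsum_mul_left]
  have hx2 : 0 < x / 2 := half_pos hx
  refine hasDerivAt_tsum_of_isPreconnected (t := Ioi (x / 2)) (y₀ := x)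
    (g := fun (k : ℕ) y => primitiveRight φ (((k : ℝ) + 1) * y)⁻¹)
    (g' := fun (k : ℕ) y =>
      -(y ^ 2)⁻¹ * (extendRight φ (((k : ℝ) + 1) * y)⁻¹ * ((k : ℝ) + 1)⁻¹))
    ((summable_succ_rpow_mul.mul_left (C * (x / 2)⁻¹ ^ (1 / 4 : ℝ))).mul_left ((x / 2) ^ 2)⁻¹)
    isOpen_Ioi isPreconnected_Ioi (fun k y hy => ?_) (fun k y hy => ?_)
    (half_lt_self hx) (hφ.summable_dilateSum hx) (half_lt_self hx)
  · have hy0 : 0 < y := hx2.trans hy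
    have hk : (0 : ℝ) < (k : ℝ) + 1 := by positivity
    have h := (hφ.hasDerivAt_primitiveRight
      (show 0 < (((k : ℝ) + 1) * y)⁻¹ by positivity)).comp y
        (hasDerivAt_inv_const_mul hk.ne' hy0.ne')
    exact h.congr_deriv (by ring)
  · have hy2 : x / 2 ≤ y := le_of_lt hy
    rw [norm_mul]
    refine mul_le_mul ?_ (abs_weightedDilateSum_term_le hC0 hC hx2 hy2 k) (norm_nonneg _)
      (by positivity)
    rw [norm_neg, Real.norm_eq_abs, abs_of_nonneg (by positivity)]
    exact inv_anti₀ (by positivity) (pow_le_pow_left₀ hx2.le hy2 2)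

theorem hasDerivAt_smoothPiece (hφ : IsKernelEigenfunction φ lam) (n : ℕ) {x : ℝ} (hx : 0 < x) :
    HasDerivAt (smoothPiece φ lam n) (smoothPieceDeriv φ lam n x) x := by
  have h1 : HasDerivAt (fun x : ℝ => ∑ j ∈ Finset.range n, ((((j : ℝ) + 1) * x)⁻¹ - 1))
      (∑ j ∈ Finset.range n, -(x ^ 2)⁻¹ * ((j : ℝ) + 1)⁻¹) x :=
    HasDerivAt.fun_sum fun j _ =>
      (hasDerivAt_inv_const_mul (by positivity) hx.ne').sub_const 1
  have h2 := (((hasDerivAt_inv hx.ne').const_mul (PhiOne φ)).const_sub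
    ((∫ y in Ioc (0 : ℝ) 1, φ y) / 2)).add ((hφ.hasDerivAt_dilateSum hx).sub (h1.const_mul (φ 1)))
  refine (h2.const_mul lam).congr_deriv ?_
  rw [smoothPieceDeriv, ← Finset.mul_sum]
  ring

theorem contDiffOn_smoothPiece (hφ : IsKernelEigenfunction φ lam) (n : ℕ) :
    ContDiffOn ℝ 1 (smoothPiece φ lam n) (Ioi 0) := by
  refine contDiffOn_one_of_hasDerivAt isOpen_Ioi (fun x hx => hφ.hasDerivAt_smoothPiece n hx) ?_
  have h := hφ.continuousOn_weightedDilateSum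
  have hinv : ContinuousOn (fun x : ℝ => (x ^ 2)⁻¹) (Ioi 0) :=
    (continuousOn_id.pow 2).inv₀ fun x hx => pow_ne_zero 2 (ne_of_gt hx)
  exact continuousOn_const.mul (hinv.mul ((continuousOn_const.sub h).add continuousOn_const))

/-- On `[1 / (n + 1), 1 / n]` one has `1 / (m x) ≥ 1` for `m ≤ n` and `1 / (m x) ≤ 1` for `m > n`,
so the truncation of the primitive at `1` contributes a fixed finite sum. -/
theorem eq_smoothPiece (hφ : IsKernelEigenfunction φ lam) {n : ℕ} (hn : 1 ≤ n) {x : ℝ}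
    (hx : x ∈ Icc (1 / ((n : ℝ) + 1)) (1 / n)) : φ x = smoothPiece φ lam n x := by
  have hn1 : (1 : ℝ) ≤ n := by exact_mod_cast hn
  have hn0 : (0 : ℝ) < n := by linarith
  have hx0 : 0 < x := lt_of_lt_of_le (by positivity) hx.1
  have hx1 : x ≤ 1 := hx.2.trans (by rw [div_le_one hn0]; exact hn1)
  have hlo : 1 ≤ x * ((n : ℝ) + 1) := (div_le_iff₀ (by positivity)).1 hx.1
  have hhi : x * n ≤ 1 := (le_div_iff₀ hn0).1 hx.2
  have hzero : ∀ k ∉ Finset.range n, max ((((k : ℝ) + 1) * x)⁻¹ - 1) 0 = 0 := by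
    intro k hk
    have hk' : (n : ℝ) ≤ k := by exact_mod_cast not_lt.1 (fun h => hk (Finset.mem_range.2 h))
    refine max_eq_right (sub_nonpos.2 (inv_le_one_of_one_le₀ ?_))
    nlinarith
  have hsum : ∑' k : ℕ, max ((((k : ℝ) + 1) * x)⁻¹ - 1) 0 =
      ∑ j ∈ Finset.range n, ((((j : ℝ) + 1) * x)⁻¹ - 1) := by
    rw [tsum_eq_sum hzero]
    refine Finset.sum_congr rfl fun k hk => max_eq_left (sub_nonneg.2 ((one_le_inv₀ ?_).2 ?_))
    · positivity
    · have hk' : (k : ℝ) + 1 ≤ n := by exact_mod_cast Finset.mem_range.1 hk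
      nlinarith
  have hsummable : Summable fun k : ℕ => max ((((k : ℝ) + 1) * x)⁻¹ - 1) 0 :=
    summable_of_ne_finset_zero (s := Finset.range n) hzero
  rw [hφ.eq_tsum_setIntegral ⟨hx0, hx1⟩, smoothPiece, dilateSum, ← hsum, ← tsum_mul_left,
    ← (hφ.summable_dilateSum hx0).tsum_sub (hsummable.mul_left _)]
  congr 3
  exact funext fun k => hφ.setIntegral_eq_primitiveRight (by positivity)

theorem eq_smoothPiece_one (hφ : IsKernelEigenfunction φ lam) {x : ℝ}
    (hx : x ∈ Icc (1 / 2 : ℝ) 1) : φ x = smoothPiece φ lam 1 x :=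
  hφ.eq_smoothPiece le_rfl (by norm_num; exact ⟨by linarith [hx.1], hx.2⟩)

end IsKernelEigenfunction

/-! ### One-sided derivatives and differentiability -/

namespace IsKernelEigenfunction

variable {φ : ℝ → ℝ} {lam : ℝ}

theorem hasDerivWithinAt_Icc_one (hφ : IsKernelEigenfunction φ lam) :
    HasDerivWithinAt φ (smoothPieceDeriv φ lam 1 1) (Icc 0 1) 1 := by
  refine (hφ.hasDerivAt_smoothPiece 1 one_pos).hasDerivWithinAt.congr_of_eventuallyEq ?_
    (hφ.eq_smoothPiece_one ⟨by norm_num, le_rfl⟩)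
  have hnear : ∀ᶠ y : ℝ in nhdsWithin 1 (Icc 0 1), 1 / 2 < y :=
    nhdsWithin_le_nhds (Ioi_mem_nhds (by norm_num))
  filter_upwards [hnear, self_mem_nhdsWithin] with y hy hy1
  exact hφ.eq_smoothPiece_one ⟨hy.le, hy1.2⟩

theorem weightedDilateSum_one (hφ : IsKernelEigenfunction φ lam) :
    (Summable fun k : ℕ => φ (1 / ((k : ℝ) + 2)) / ((k : ℝ) + 2)) ∧
      weightedDilateSum φ 1 = φ 1 + ∑' k : ℕ, φ (1 / ((k : ℝ) + 2)) / ((k : ℝ) + 2) := by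
  have hterm : ∀ k : ℕ,
      extendRight φ ((((k + 1 : ℕ) : ℝ) + 1) * 1)⁻¹ * (((k + 1 : ℕ) : ℝ) + 1)⁻¹ =
        φ (1 / ((k : ℝ) + 2)) / ((k : ℝ) + 2) := by
    intro k
    have hk : ((k + 1 : ℕ) : ℝ) + 1 = (k : ℝ) + 2 := by push_cast; ring
    rw [hk, mul_one, ← one_div, extendRight_of_le, ← div_eq_mul_one_div]
    rw [div_le_one (by positivity)]
    linarith [(Nat.cast_nonneg k : (0 : ℝ) ≤ k)]
  have hs := hφ.summable_weightedDilateSum one_pos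
  refine ⟨((summable_nat_add_iff 1).2 hs).congr hterm, ?_⟩
  rw [weightedDilateSum, hs.tsum_eq_zero_add, tsum_congr hterm]
  simp [extendRight]

theorem hasDerivWithinAt_Ioi_one_div (hφ : IsKernelEigenfunction φ lam) {n : ℕ} (hn : 2 ≤ n) :
    HasDerivWithinAt φ (smoothPieceDeriv φ lam (n - 1) (1 / n)) (Ioi (1 / (n : ℝ))) (1 / n) := by
  have hn2 : (2 : ℝ) ≤ n := by exact_mod_cast hn
  have hcast : ((n - 1 : ℕ) : ℝ) = n - 1 := by rw [Nat.cast_sub (by omega), Nat.cast_one]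
  have hlt : 1 / (n : ℝ) < 1 / ((n - 1 : ℕ) : ℝ) := by
    rw [hcast]
    exact one_div_lt_one_div_of_lt (by linarith) (by linarith)
  have heq : ∀ y ∈ Icc (1 / (n : ℝ)) (1 / ((n - 1 : ℕ) : ℝ)), φ y = smoothPiece φ lam (n - 1) y :=
    fun y hy => hφ.eq_smoothPiece (by omega) (by rwa [hcast, sub_add_cancel, ← hcast])
  refine (hφ.hasDerivAt_smoothPiece (n - 1)
    (by positivity)).hasDerivWithinAt.congr_of_eventuallyEq ?_ (heq _ ⟨le_rfl, hlt.le⟩)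
  filter_upwards [nhdsWithin_le_nhds (Iio_mem_nhds hlt), self_mem_nhdsWithin] with y hy hy1
  exact heq y ⟨le_of_lt hy1, le_of_lt hy⟩

theorem hasDerivWithinAt_Iio_one_div (hφ : IsKernelEigenfunction φ lam) {n : ℕ} (hn : 1 ≤ n) :
    HasDerivWithinAt φ (smoothPieceDeriv φ lam n (1 / n)) (Iio (1 / (n : ℝ))) (1 / n) := by
  have hn0 : (0 : ℝ) < n := by exact_mod_cast hn
  have hlt : 1 / ((n : ℝ) + 1) < 1 / (n : ℝ) := one_div_lt_one_div_of_lt hn0 (by linarith)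
  refine (hφ.hasDerivAt_smoothPiece n
    (by positivity)).hasDerivWithinAt.congr_of_eventuallyEq ?_
    (hφ.eq_smoothPiece hn ⟨hlt.le, le_rfl⟩)
  filter_upwards [nhdsWithin_le_nhds (Ioi_mem_nhds hlt), self_mem_nhdsWithin] with y hy hy1
  exact hφ.eq_smoothPiece hn ⟨le_of_lt hy, le_of_lt hy1⟩

theorem smoothPieceDeriv_sub (φ : ℝ → ℝ) (lam : ℝ) {n : ℕ} (hn : 1 ≤ n) :
    smoothPieceDeriv φ lam (n - 1) (1 / n) - smoothPieceDeriv φ lam n (1 / n) =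
      -lam * φ 1 * n := by
  obtain ⟨m, rfl⟩ : ∃ m, n = m + 1 := ⟨n - 1, by omega⟩
  have hm : (m : ℝ) + 1 ≠ 0 := by positivity
  rw [smoothPieceDeriv, smoothPieceDeriv, Nat.add_sub_cancel, Finset.sum_range_succ]
  push_cast
  field_simp
  ring

/-- At `1 / n` the two one-sided derivatives differ by `-lam * φ 1 * n ≠ 0`. -/
theorem not_differentiableWithinAt_one_div (hφ : IsKernelEigenfunction φ lam) (h1 : φ 1 ≠ 0)
    {n : ℕ} (hn : 2 ≤ n) : ¬ DifferentiableWithinAt ℝ φ (Icc 0 1) (1 / (n : ℝ)) := by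
  intro hd
  have hn2 : (2 : ℝ) ≤ n := by exact_mod_cast hn
  have hnhds : Icc (0 : ℝ) 1 ∈ nhds (1 / (n : ℝ)) :=
    Icc_mem_nhds (by positivity) (by rw [div_lt_one (by positivity)]; linarith)
  have hderiv := (hd.differentiableAt hnhds).hasDerivAt
  have hr := (uniqueDiffWithinAt_Ioi (1 / (n : ℝ))).eq_deriv _ hderiv.hasDerivWithinAt
    (hφ.hasDerivWithinAt_Ioi_one_div hn)
  have hl := (uniqueDiffWithinAt_Iio (1 / (n : ℝ))).eq_deriv _ hderiv.hasDerivWithinAt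
    (hφ.hasDerivWithinAt_Iio_one_div (by omega))
  have hsub := smoothPieceDeriv_sub φ lam (n := n) (by omega)
  rw [← hr, ← hl, sub_self] at hsub
  exact mul_ne_zero (mul_ne_zero (neg_ne_zero.2 hφ.lam_ne_zero) h1) (by positivity) hsub.symm

theorem exists_mem_Icc_one_div {x : ℝ} (hx : x ∈ Ioc (0 : ℝ) 1) :
    ∃ n : ℕ, 1 ≤ n ∧ x ∈ Ioc (1 / ((n : ℝ) + 1)) (1 / n) := by
  have hinv : 1 ≤ x⁻¹ := (one_le_inv₀ hx.1).2 hx.2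
  have hn : 1 ≤ ⌊x⁻¹⌋₊ := (Nat.one_le_floor_iff _).2 hinv
  refine ⟨⌊x⁻¹⌋₊, hn, ?_, ?_⟩
  · rw [one_div]
    exact inv_lt_of_inv_lt₀ hx.1 (Nat.lt_floor_add_one _)
  · rw [one_div]
    exact (le_inv_comm₀ hx.1 (by exact_mod_cast hn)).2 (Nat.floor_le (by positivity))

theorem differentiableWithinAt (hφ : IsKernelEigenfunction φ lam) {x : ℝ}
    (hx : x ∈ Ioc (0 : ℝ) 1) (hne : ∀ n : ℕ, 2 ≤ n → x ≠ 1 / n) :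
    DifferentiableWithinAt ℝ φ (Icc 0 1) x := by
  obtain ⟨n, hn, hlo, hhi⟩ := exists_mem_Icc_one_div hx
  rcases hn.eq_or_lt with rfl | hn2
  · rcases hx.2.eq_or_lt with rfl | hx1
    · exact hφ.hasDerivWithinAt_Icc_one.differentiableWithinAt
    · refine ((hφ.hasDerivAt_smoothPiece 1 hx.1).congr_of_eventuallyEq
        ?_).differentiableAt.differentiableWithinAt
      filter_upwards [Ioo_mem_nhds hlo hx1] with y hy
      exact hφ.eq_smoothPiece le_rfl ⟨hy.1.le, by simpa using hy.2.le⟩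
  · refine ((hφ.hasDerivAt_smoothPiece n hx.1).congr_of_eventuallyEq
      ?_).differentiableAt.differentiableWithinAt
    filter_upwards [Ioo_mem_nhds hlo (lt_of_le_of_ne hhi (hne n hn2))] with y hy
    exact hφ.eq_smoothPiece hn ⟨hy.1.le, hy.2.le⟩

theorem smoothPiece_eq_zero_piece (h1 : φ 1 = 0) (n : ℕ) (x : ℝ) :
    smoothPiece φ lam n x = smoothPiece φ lam 0 x := by
  simp [smoothPiece, h1]

theorem eq_smoothPiece_zero (hφ : IsKernelEigenfunction φ lam) (h1 : φ 1 = 0) {x : ℝ}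
    (hx : x ∈ Ioc (0 : ℝ) 1) : φ x = smoothPiece φ lam 0 x := by
  obtain ⟨n, hn, hxn⟩ := exists_mem_Icc_one_div hx
  rw [← smoothPiece_eq_zero_piece h1 n, hφ.eq_smoothPiece hn (Ioc_subset_Icc_self hxn)]

theorem hasDerivWithinAt_of_one_eq_zero (hφ : IsKernelEigenfunction φ lam) (h1 : φ 1 = 0) {x : ℝ}
    (hx : x ∈ Ioc (0 : ℝ) 1) :
    HasDerivWithinAt φ (smoothPieceDeriv φ lam 0 x) (Icc 0 1) x := by
  refine (hφ.hasDerivAt_smoothPiece 0 hx.1).hasDerivWithinAt.congr_of_eventuallyEq ?_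
    (hφ.eq_smoothPiece_zero h1 hx)
  filter_upwards [nhdsWithin_le_nhds (Ioi_mem_nhds hx.1), self_mem_nhdsWithin] with y hy hy1
  exact hφ.eq_smoothPiece_zero h1 ⟨hy, hy1.2⟩

/-- When `φ 1 = 0`, the terms of `weightedDilateSum` with `m ≤ 1 / x` vanish. -/
theorem tailTerm_succ (h1 : φ 1 = 0) {x : ℝ} (hx : 0 < x) (k : ℕ) :
    tailTerm φ x (k + 1) = extendRight φ (((k : ℝ) + 1) * x)⁻¹ * ((k : ℝ) + 1)⁻¹ := by
  have hk : (0 : ℝ) < (k : ℝ) + 1 := by positivity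
  rw [tailTerm, Nat.cast_succ]
  split_ifs with h
  · rw [div_lt_iff₀ hx] at h
    rw [extendRight_of_le (inv_le_one_of_one_le₀ h.le), one_div, div_eq_mul_inv]
  · rw [not_lt, le_div_iff₀ hx] at h
    rw [extendRight_of_ge ((one_le_inv₀ (by positivity)).2 h), h1, zero_mul]

theorem summable_tailTerm (hφ : IsKernelEigenfunction φ lam) (h1 : φ 1 = 0) {x : ℝ} (hx : 0 < x) :
    Summable (tailTerm φ x) :=
  (summable_nat_add_iff 1).1
    ((hφ.summable_weightedDilateSum hx).congr fun k => (tailTerm_succ h1 hx k).symm)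

theorem tsum_tailTerm (hφ : IsKernelEigenfunction φ lam) (h1 : φ 1 = 0) {x : ℝ} (hx : 0 < x) :
    ∑' m : ℕ, tailTerm φ x m = weightedDilateSum φ x := by
  have h0 : tailTerm φ x 0 = 0 := by simp [tailTerm]
  rw [(hφ.summable_tailTerm h1 hx).tsum_eq_zero_add, h0, zero_add, weightedDilateSum]
  exact tsum_congr (tailTerm_succ h1 hx)

end IsKernelEigenfunction

theorem corollary4p3 (φ : ℝ → ℝ) (lam : ℝ) (hφ : IsKernelEigenfunction φ lam) :
    -- continuous differentiability on `(1/2, 1]` (one-sided derivative at `1`)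
    ContDiffOn ℝ 1 φ (Ioc (1 / 2 : ℝ) 1) ∧
    -- the integral and the series in the formula for the derivative at `1` converge absolutely
    IntegrableOn (fun y : ℝ => φ y / y) (Icc (0 : ℝ) 1) ∧
    Summable (fun k : ℕ => φ (1 / ((k : ℝ) + 2)) / ((k : ℝ) + 2)) ∧
    -- the derivative at `1`, where `m = k + 2` runs over the integers `m ≥ 2`
    HasDerivWithinAt φ
      (lam * PhiOne φ - lam * ∑' k : ℕ, φ (1 / ((k : ℝ) + 2)) / ((k : ℝ) + 2))
      (Icc (0 : ℝ) 1) 1 ∧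
    -- existence of the one-sided derivatives at `1/n` and their difference
    (∀ n : ℕ, 2 ≤ n → ∃ dplus dminus : ℝ,
      HasDerivWithinAt φ dplus (Ioi (1 / (n : ℝ))) (1 / (n : ℝ)) ∧
      HasDerivWithinAt φ dminus (Iio (1 / (n : ℝ))) (1 / (n : ℝ)) ∧
      dplus - dminus = -lam * φ 1 * (n : ℝ)) ∧
    -- the case `φ(1) ≠ 0`
    (φ 1 ≠ 0 →
      {x : ℝ | x ∈ Ioc (0 : ℝ) 1 ∧ ¬ DifferentiableWithinAt ℝ φ (Icc (0 : ℝ) 1) x} =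
        {x : ℝ | ∃ n : ℕ, 2 ≤ n ∧ x = 1 / (n : ℝ)}) ∧
    -- the case `φ(1) = 0`
    (φ 1 = 0 →
      ContDiffOn ℝ 1 φ (Ioc (0 : ℝ) 1) ∧
      ∀ x ∈ Ioc (0 : ℝ) 1, Summable (tailTerm φ x) ∧
        ∃ d : ℝ, HasDerivWithinAt φ d (Icc (0 : ℝ) 1) x ∧
          lam⁻¹ * x ^ 2 * d = PhiOne φ - ∑' m : ℕ, tailTerm φ x m) := by
  have hlam := hφ.lam_ne_zero
  refine ⟨?_, ?_, hφ.weightedDilateSum_one.1, ?_, fun n hn => ?_, fun h1 => ?_, fun h1 => ?_⟩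
  · exact ((hφ.contDiffOn_smoothPiece 1).mono fun x hx => one_half_pos.trans hx.1).congr
      fun x hx => hφ.eq_smoothPiece_one ⟨hx.1.le, hx.2⟩
  · rw [integrableOn_Icc_iff_integrableOn_Ioc]
    exact hφ.integrableOn_div
  · convert hφ.hasDerivWithinAt_Icc_one using 1
    rw [smoothPieceDeriv, hφ.weightedDilateSum_one.2]
    simp
    ring
  · exact ⟨_, _, hφ.hasDerivWithinAt_Ioi_one_div hn, hφ.hasDerivWithinAt_Iio_one_div (by omega),
      IsKernelEigenfunction.smoothPieceDeriv_sub φ lam (by omega)⟩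
  · ext x
    constructor
    · rintro ⟨hx, hnd⟩
      by_contra hne
      exact hnd (hφ.differentiableWithinAt hx fun n hn h => hne ⟨n, hn, h⟩)
    · rintro ⟨n, hn, rfl⟩
      have hn1 : (1 : ℝ) ≤ n := by exact_mod_cast (by omega : 1 ≤ n)
      exact ⟨⟨by positivity, by rw [div_le_one (by positivity)]; exact hn1⟩,
        hφ.not_differentiableWithinAt_one_div h1 hn⟩
  · refine ⟨?_, fun x hx => ⟨hφ.summable_tailTerm h1 hx.1, _,
      hφ.hasDerivWithinAt_of_one_eq_zero h1 hx, ?_⟩⟩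
    · exact ((hφ.contDiffOn_smoothPiece 0).mono fun x hx => hx.1).congr
        fun x hx => hφ.eq_smoothPiece_zero h1 hx
    · have hx0 : x ≠ 0 := hx.1.ne'
      rw [hφ.tsum_tailTerm h1 hx.1, smoothPieceDeriv, h1]
      field_simp
      ring
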